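/- All rings are unitary, not necessarily commutative, and may be zero; $U(B)$ is the group of invertible elements of $B$. For $S\subseteq A$ let $A\to A_S$ be the universal homomorphism that makes the elements of $S$ invertible, and $A_a=A_{\{a\}}$. A homomorphism $\varphi:A\to B$ to a nonzero ring defines a sequence $\mathcal S=(S_1,S_2,\dots)$, the *fully invertible system coming from $\varphi$*: put $A_0=A$, $\varphi_0=\varphi$, and inductively $S_{n+1}=\varphi_n^{-1}(U(B))\subseteq A_n$, $A_{n+1}=(A_n)_{S_{n+1}}$, with $\varphi_{n+1}:A_{n+1}\to B$ induced by $\varphi_n$. The rings $A_n$ depend only on $\mathcal S$; put $A_{\mathcal S}=\varinjlim_n A_n$. The *full spectrum* $F(A)$ is the set of all fully invertible systems on $A$ (so $F(0)=\emptyset$). A *fraction* of $A$ is a tuple $\mathbf a=(a_1,\dots,a_n)$ with $a_1\in A$, $a_2\in A_{a_1}$, $a_3\in (A_{a_1})_{a_2}$, …; write $A_{\mathbf a}=(\cdots(A_{a_1})_{a_2}\cdots)_{a_n}$. Let $D(\mathbf a)\subseteq F(A)$ be the set of those $\mathcal S$ for which $a_1,\dots,a_n$ successively become invertible in $A_{\mathcal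 S}$, i.e. for which $A\to A_{\mathcal S}$ factors (then uniquely) through $A\to A_{\mathbf a}$. Give $F(A)$ the topology generated by the sets $D(\mathbf a)$, and the sheaf of rings $\mathcal O_A$ for which $\mathcal O_A(U)$ is the ring of functions $t$ on $U$ with $t(\mathcal S)\in A_{\mathcal S}$ that are locally given by an element of some $A_{\mathbf a}$: every point of $U$ has an open neighbourhood $V\subseteq U$ for which there are a fraction $\mathbf a$ with $V\subseteq D(\mathbf a)$ and $b\in A_{\mathbf a}$ such that $t(\mathcal S)$ is the image of $b$ in $A_{\mathcal S}$ for all $\mathcal S\in V$. An *affine F-scheme* is a ringed space isomorphic to $(F(A),\mathcal O_A)$ for some ring $A$. An *F-scheme* is a ringed space in which every point has an open neighbourhood that is an affine F-scheme. Call an F-scheme *$0$-affine* if it is affine. For $n\ge 1$, an F-scheme $X$ is *$n$-affine* if (1) $X$ has a covering by affine open subspaces $U_i$ such that each $U_i\cap U_j$ is $m$-affine for some $m\le n-1$ (which may depend on $i,j$), and (2) $X$ is not $m$-affine for any $m<n$. **Lemma.** Every F-scheme is affine, $1$-affine or $2$-affine. -/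

import Mathlib

universe u

open CategoryTheory TopologicalSpace Opposite

noncomputable section

namespace FS

section Localization

/-- The relations in the presentation `⟨A, x_s (s ∈ S) | x_s s = s x_s = 1⟩`: the ring structure
of `A` (`Sum.inl a` is the generator given by `a ∈ A`), and `x_s` (the generator `Sum.inr s`) is a
two-sided inverse of `s`. -/
inductive LocRel {A : Type u} [Ring A] (S : Set A) :
    FreeRing (A ⊕ S) → FreeRing (A ⊕ S) → Prop
  | one : LocRel S (FreeRing.of (Sum.inl 1)) 1
  | add (a b : A) : LocRel S (FreeRing.of (Sum.inl (a + b)))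
      (FreeRing.of (Sum.inl a) + FreeRing.of (Sum.inl b))
  | mul (a b : A) : LocRel S (FreeRing.of (Sum.inl (a * b)))
      (FreeRing.of (Sum.inl a) * FreeRing.of (Sum.inl b))
  | mul_inv (s : S) : LocRel S (FreeRing.of (Sum.inl s.1) * FreeRing.of (Sum.inr s)) 1
  | inv_mul (s : S) : LocRel S (FreeRing.of (Sum.inr s) * FreeRing.of (Sum.inl s.1)) 1

/-- The (universal) localization `A_S` of a ring `A` at a subset `S`. -/
def Loc {A : Type u} [Ring A] (S : Set A) : Type u := RingQuot (LocRel S)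

instance {A : Type u} [Ring A] (S : Set A) : Ring (Loc S) :=
  inferInstanceAs (Ring (RingQuot (LocRel S)))

namespace Loc

variable {A B C : Type u} [Ring A] [Ring B] [Ring C] {S : Set A}

/-- The quotient map from the free ring on the generators. -/
def mk (S : Set A) : FreeRing (A ⊕ S) →+* Loc S := RingQuot.mkRingHom (LocRel S)

theorem mk_rel {x y : FreeRing (A ⊕ S)} (h : LocRel S x y) : mk S x = mk S y :=
  RingQuot.mkRingHom_rel h

/-- The natural homomorphism `i_S : A → A_S`. -/
def of (S : Set A) : A →+* Loc S :=
  RingHom.mk' ⟨⟨fun a => mk S (FreeRing.of (Sum.inl a)),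
      (mk_rel LocRel.one).trans (map_one _)⟩,
    fun a b => (mk_rel (LocRel.mul a b)).trans (map_mul _ _ _)⟩
    fun a b => (mk_rel (LocRel.add a b)).trans (map_add _ _ _)

theorem of_apply (a : A) : of S a = mk S (FreeRing.of (Sum.inl a)) := rfl

theorem of_mul_inv (s : S) : of S s.1 * mk S (FreeRing.of (Sum.inr s)) = 1 := by
  rw [of_apply, ← map_mul, mk_rel (LocRel.mul_inv s), map_one]

theorem inv_mul_of (s : S) : mk S (FreeRing.of (Sum.inr s)) * of S s.1 = 1 := by
  rw [of_apply, ← map_mul, mk_rel (LocRel.inv_mul s), map_one]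

theorem isUnit_of {s : A} (hs : s ∈ S) : IsUnit (of S s) :=
  ⟨⟨_, _, of_mul_inv ⟨s, hs⟩, inv_mul_of ⟨s, hs⟩⟩, rfl⟩

/-- The homomorphism `φ_S : A_S → B` induced by a homomorphism `φ : A → B` that makes all elements
of `S` invertible. -/
def lift (φ : A →+* B) (h : ∀ s ∈ S, IsUnit (φ s)) : Loc S →+* B :=
  RingQuot.lift ⟨FreeRing.lift (Sum.elim φ fun s => ((h s.1 s.2).unit⁻¹ : Bˣ)), by
    intro x y hxy
    cases hxy <;> simp⟩

@[simp]
theorem lift_of (φ : A →+* B) (h : ∀ s ∈ S, IsUnit (φ s)) (a : A) :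
    lift φ h (of S a) = φ a := by
  rw [of_apply, mk, lift]
  erw [RingQuot.lift_mkRingHom_apply]
  simp

theorem lift_comp_of (φ : A →+* B) (h : ∀ s ∈ S, IsUnit (φ s)) :
    (lift φ h).comp (of S) = φ := RingHom.ext (lift_of φ h)

theorem hom_ext {f g : Loc S →+* B} (h : f.comp (of S) = g.comp (of S)) : f = g := by
  refine RingQuot.ringQuot_ext f g (FreeRing.hom_ext ?_)
  rintro (a | s)
  · exact congr($h a)
  · have hs : f (of S s.1) = g (of S s.1) := congr($h s.1)
    have h1 : f (mk S (FreeRing.of (Sum.inr s))) * f (of S s.1) = 1 := by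
      rw [← map_mul, inv_mul_of, map_one]
    have h2 : f (of S s.1) * g (mk S (FreeRing.of (Sum.inr s))) = 1 := by
      rw [hs, ← map_mul, of_mul_inv, map_one]
    exact left_inv_eq_right_inv h1 h2

theorem lift_of_self : lift (of S) (fun _ => isUnit_of) = RingHom.id (Loc S) :=
  hom_ext (lift_comp_of _ _)

theorem lift_comp (f : Loc S →+* B) (h : ∀ s ∈ S, IsUnit (f.comp (of S) s)) :
    lift (f.comp (of S)) h = f := hom_ext (lift_comp_of _ _)

end Loc

end Localization

/-- A chain of length `n` on `A`: a tuple `(S₁, …, Sₙ)` with `S₁ ⊆ A`, `S₂ ⊆ A_{S₁}`,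
`S₃ ⊆ (A_{S₁})_{S₂}`, and so on. -/
def Chain : ℕ → (A : Type u) → [Ring A] → Type u
  | 0, _, _ => PUnit
  | n + 1, A, _ => Σ S : Set A, Chain n (Loc S)

namespace Chain

/-- The iterated localization `(…((A_{S₁})_{S₂})…)_{Sₙ}` at a chain. -/
def ring : {n : ℕ} → {A : Type u} → [Ring A] → Chain n A → RingCat.{u}
  | 0, A, _, _ => RingCat.of A
  | _ + 1, _, _, p => ring p.2

/-- The natural homomorphism from `A` to its iterated localization. -/
def base : {n : ℕ} → {A : Type u} → [Ring A] → (p : Chain n A) → A →+* p.ring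
  | 0, A, _, _ => RingHom.id A
  | _ + 1, _, _, p => (base p.2).comp (Loc.of p.1)

/-- `φ : A → B` inverts the chain `(S₁, …, Sₙ)`: the images of the elements of `S₁` under `φ` are
invertible, those of the elements of `S₂` under the induced map `A_{S₁} → B` are, and so on. -/
def Inverts : {n : ℕ} → {A B : Type u} → [Ring A] → [Ring B] → (A →+* B) → Chain n A → Prop
  | 0, _, _, _, _, _, _ => True
  | _ + 1, _, _, _, _, φ, p => ∃ h : ∀ s ∈ p.1, IsUnit (φ s), Inverts (Loc.lift φ h) p.2

/-- The homomorphism from the iterated localization induced by `φ : A → B` inverting the chain. -/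
def lift : {n : ℕ} → {A B : Type u} → [Ring A] → [Ring B] → (φ : A →+* B) → (p : Chain n A) →
    Inverts φ p → p.ring →+* B
  | 0, _, _, _, _, φ, _, _ => φ
  | _ + 1, _, _, _, _, φ, p, h => lift (Loc.lift φ h.fst) p.2 h.snd

/-- The chain is a fraction `(a₁, …, aₙ)`, `a₁ ∈ A`, `a₂ ∈ A_{a₁}`, …: all its sets are
singletons. -/
def IsFraction : {n : ℕ} → {A : Type u} → [Ring A] → Chain n A → Prop
  | 0, _, _, _ => True
  | _ + 1, _, _, p => (∃ a, p.1 = {a}) ∧ IsFraction p.2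

/-- The first `n` terms `(S₁, …, Sₙ)` of the fully invertible system coming from `φ : A → B`:
`S₁ = A ∩ U(B)`, then `S₂ = A_{S₁} ∩ U(B)` for the induced map `A_{S₁} → B`, and so on. -/
def ofHom : (n : ℕ) → {A B : Type u} → [Ring A] → [Ring B] → (A →+* B) → Chain n A
  | 0, _, _, _, _, _ => PUnit.unit
  | n + 1, _, _, _, _, φ =>
    ⟨{a | IsUnit (φ a)}, ofHom n (Loc.lift (S := {a | IsUnit (φ a)}) φ fun _ h => h)⟩

theorem lift_comp_base {n : ℕ} {A B : Type u} [Ring A] [Ring B] (φ : A →+* B) (p : Chain n A)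
    (h : Inverts φ p) : (lift φ p h).comp p.base = φ := by
  induction n generalizing A with
  | zero => rfl
  | succ n ih =>
    change ((lift _ p.2 h.snd).comp p.2.base).comp (Loc.of p.1) = φ
    rw [ih, Loc.lift_comp_of]

theorem hom_ext {n : ℕ} {A B : Type u} [Ring A] [Ring B] (p : Chain n A) {f g : p.ring →+* B}
    (h : f.comp p.base = g.comp p.base) : f = g := by
  induction n generalizing A with
  | zero => exact h
  | succ n ih => exact ih p.2 (Loc.hom_ext h)

theorem Inverts.comp {n : ℕ} {A B C : Type u} [Ring A] [Ring B] [Ring C] {φ : A →+* B}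
    {p : Chain n A} (h : Inverts φ p) (f : B →+* C) : Inverts (f.comp φ) p := by
  induction n generalizing A with
  | zero => trivial
  | succ n ih =>
    obtain ⟨h1, h2⟩ := h
    refine ⟨fun s hs => (h1 s hs).map f, ?_⟩
    have e : Loc.lift (f.comp φ) (fun s hs => (h1 s hs).map f) = f.comp (Loc.lift φ h1) :=
      Loc.hom_ext (by rw [Loc.lift_comp_of, RingHom.comp_assoc, Loc.lift_comp_of])
    rw [e]
    exact ih h2

theorem inverts_base {n : ℕ} {A : Type u} [Ring A] (p : Chain n A) : Inverts p.base p := by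
  induction n generalizing A with
  | zero => trivial
  | succ n ih =>
    have h1 : ∀ s ∈ p.1, IsUnit (p.2.base.comp (Loc.of p.1) s) :=
      fun s hs => (Loc.isUnit_of hs).map p.2.base
    refine ⟨h1, ?_⟩
    change Inverts (Loc.lift (p.2.base.comp (Loc.of p.1)) h1) p.2
    rw [Loc.lift_comp]
    exact ih p.2

theorem inverts_base_ofHom {m n : ℕ} (hmn : m ≤ n) {A B : Type u} [Ring A] [Ring B]
    (φ : A →+* B) : Inverts (ofHom n φ).base (ofHom m φ) := by
  induction m generalizing A n with
  | zero => trivial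
  | succ m ih =>
    obtain _ | n := n
    · omega
    have h1 : ∀ s ∈ (ofHom (m + 1) φ).1, IsUnit ((ofHom (n + 1) φ).base s) :=
      fun s hs => (Loc.isUnit_of (S := {a | IsUnit (φ a)}) hs).map
        (base (ofHom n (Loc.lift (S := {a | IsUnit (φ a)}) φ fun _ h => h)))
    refine ⟨h1, ?_⟩
    change Inverts (Loc.lift ((base (ofHom n (Loc.lift (S := {a | IsUnit (φ a)}) φ fun _ h => h))).comp
      (Loc.of _)) h1) (ofHom m (Loc.lift (S := {a | IsUnit (φ a)}) φ fun _ h => h))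
    exact (congrArg (fun f => Inverts f (ofHom m _)) (Loc.lift_comp _ h1)).mpr (ih (by omega) _)

/-- The image of a chain under a ring homomorphism. -/
def push : {n : ℕ} → {A B : Type u} → [Ring A] → [Ring B] → (A →+* B) → Chain n A → Chain n B
  | 0, _, _, _, _, _, _ => PUnit.unit
  | _ + 1, _, _, _, _, ψ, p =>
    ⟨ψ '' p.1, push (Loc.lift ((Loc.of (ψ '' p.1)).comp ψ) fun _ hs =>
      Loc.isUnit_of (Set.mem_image_of_mem ψ hs)) p.2⟩

theorem IsFraction.push {n : ℕ} {A B : Type u} [Ring A] [Ring B] (ψ : A →+* B) {p : Chain n A}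
    (h : IsFraction p) : IsFraction (push ψ p) := by
  induction n generalizing A B with
  | zero => trivial
  | succ n ih =>
    obtain ⟨⟨a, ha⟩, h2⟩ := h
    exact ⟨⟨ψ a, by change ψ '' p.1 = _; rw [ha, Set.image_singleton]⟩, ih _ h2⟩

theorem inverts_push {n : ℕ} {A B C : Type u} [Ring A] [Ring B] [Ring C] (ψ : A →+* B)
    (φ : B →+* C) (p : Chain n A) : Inverts φ (push ψ p) ↔ Inverts (φ.comp ψ) p := by
  induction n generalizing A B with
  | zero => exact Iff.rfl
  | succ n ih =>
    have key : ∀ (h1 : ∀ s ∈ ψ '' p.1, IsUnit (φ s)) (h2 : ∀ s ∈ p.1, IsUnit (φ.comp ψ s)),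
        (Loc.lift φ h1).comp (Loc.lift ((Loc.of (ψ '' p.1)).comp ψ) fun _ hs =>
          Loc.isUnit_of (Set.mem_image_of_mem ψ hs)) = Loc.lift (φ.comp ψ) h2 := by
      intro h1 h2
      apply Loc.hom_ext
      rw [RingHom.comp_assoc, Loc.lift_comp_of, Loc.lift_comp_of, ← RingHom.comp_assoc,
        Loc.lift_comp_of]
    constructor
    · rintro ⟨h1, h2⟩
      refine ⟨fun s hs => h1 _ (Set.mem_image_of_mem ψ hs), ?_⟩
      exact (congrArg (fun f => Inverts f p.2) (key h1 _)).mp ((ih _ _ p.2).1 h2)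
    · rintro ⟨h1, h2⟩
      have h1' : ∀ s ∈ ψ '' p.1, IsUnit (φ s) := by
        rintro _ ⟨s, hs, rfl⟩
        exact h1 s hs
      exact ⟨h1', (ih _ _ p.2).2 ((congrArg (fun f => Inverts f p.2) (key h1' h1)).mpr h2)⟩

theorem exists_inter_aux {m n : ℕ} {A B : Type u} [Ring A] [Ring B] (ψ : B →+* A)
    (a : Chain m A) (ha : IsFraction a) (b : Chain n B) (hb : IsFraction b) :
    ∃ (k : ℕ) (c : Chain k A), IsFraction c ∧ ∀ (C : Type u) [Ring C] (φ : A →+* C),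
      Inverts φ c ↔ Inverts φ a ∧ Inverts (φ.comp ψ) b := by
  induction m generalizing A with
  | zero =>
    exact ⟨n, push ψ b, hb.push ψ, fun C _ φ =>
      (inverts_push ψ φ b).trans (iff_and_self.2 fun _ => trivial)⟩
  | succ m ih =>
    obtain ⟨k, c, hc, h⟩ := ih ((Loc.of a.1).comp ψ) a.2 ha.2
    refine ⟨k + 1, ⟨a.1, c⟩, ⟨ha.1, hc⟩, fun C _ φ => ?_⟩
    constructor
    · rintro ⟨h1, h2⟩
      obtain ⟨h3, h4⟩ := (h C _).1 h2
      rw [← RingHom.comp_assoc, Loc.lift_comp_of] at h4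
      exact ⟨⟨h1, h3⟩, h4⟩
    · rintro ⟨⟨h1, h3⟩, h4⟩
      refine ⟨h1, (h C _).2 ⟨h3, ?_⟩⟩
      rw [← RingHom.comp_assoc, Loc.lift_comp_of]
      exact h4

/-- Two fractions have a common refinement: a fraction inverted by exactly those homomorphisms
that invert both. -/
theorem exists_inter {m n : ℕ} {A : Type u} [Ring A]
    (a : Chain m A) (ha : IsFraction a) (b : Chain n A) (hb : IsFraction b) :
    ∃ (k : ℕ) (c : Chain k A), IsFraction c ∧ ∀ (C : Type u) [Ring C] (φ : A →+* C),
      Inverts φ c ↔ Inverts φ a ∧ Inverts φ b :=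
  exists_inter_aux (RingHom.id A) a ha b hb

end Chain

/-- The full spectrum `F(A)`: the set of fully invertible systems `𝒮 = (S₁, S₂, …)` on `A`, i.e.
of the sequences that come from a homomorphism of `A` to a nonzero ring. The sequence is recorded
through its initial segments `chain n = (S₁, …, Sₙ)`. The universe of `B` is no restriction: a
system is also the one coming from `A → A_𝒮`, and `A_𝒮` lives in the universe of `A`. -/
@[ext]
structure FullSpectrum (A : Type u) [Ring A] : Type u where
  /-- The initial segment `(S₁, …, Sₙ)`. -/
  chain : ∀ n, Chain n A
  exists_hom : ∃ (B : Type u) (_ : Ring B) (_ : Nontrivial B) (φ : A →+* B),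
    ∀ n, chain n = Chain.ofHom n φ

namespace FullSpectrum

section

variable {A : Type u} [Ring A] (T : FullSpectrum A)

theorem inverts {m n : ℕ} (h : m ≤ n) : Chain.Inverts (T.chain n).base (T.chain m) := by
  obtain ⟨B, _, _, φ, hφ⟩ := T.exists_hom
  rw [hφ m, hφ n]
  exact Chain.inverts_base_ofHom h φ

/-- The transition maps `A_{𝒮,m} → A_{𝒮,n}`, `m ≤ n`. -/
def trans (m n : ℕ) (h : m ≤ n) : (T.chain m).ring →+* (T.chain n).ring :=
  Chain.lift _ _ (T.inverts h)

instance : DirectedSystem (fun n => (T.chain n).ring) (T.trans · · ·) where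
  map_self i x := by
    have h : T.trans i i le_rfl = RingHom.id _ :=
      Chain.hom_ext _ (Chain.lift_comp_base _ _ _)
    exact congr($h x)
  map_map k j i hij hjk x := by
    have h : (T.trans j k hjk).comp (T.trans i j hij) = T.trans i k (hij.trans hjk) := by
      apply Chain.hom_ext
      rw [RingHom.comp_assoc]
      unfold trans
      rw [Chain.lift_comp_base, Chain.lift_comp_base, Chain.lift_comp_base]
    exact congr($h x)

/-- The localization `A_𝒮` of `A` at a fully invertible system: the direct limit of the rings
`A_{𝒮,n}`. -/
def Localization : Type u := DirectLimit (fun n => (T.chain n).ring) T.trans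

instance : Ring T.Localization :=
  inferInstanceAs (Ring (DirectLimit (fun n => (T.chain n).ring) T.trans))

/-- The natural homomorphism `i_𝒮 : A → A_𝒮`. -/
def base : A →+* T.Localization where
  toFun a := (⟦⟨0, (T.chain 0).base a⟩⟧ : DirectLimit (fun n => (T.chain n).ring) T.trans)
  map_one' := by
    rw [map_one]
    exact (DirectLimit.one_def (f := T.trans) 0).symm
  map_mul' a b := by
    rw [map_mul]
    exact (DirectLimit.mul_def (f := T.trans) 0 _ _).symm
  map_zero' := by
    rw [map_zero]
    exact (DirectLimit.zero_def (f := T.trans) 0).symm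
  map_add' a b := by
    rw [map_add]
    exact (DirectLimit.add_def (f := T.trans) 0 _ _).symm

/-- `D(a) = {𝒮 ∈ F(A) | a ∈ 𝒮}`, where `a = (a₁, …, aₙ) ∈ 𝒮` means that every `aᵢ` is
invertible in `A_𝒮`. -/
def D {n : ℕ} (a : Chain n A) : Set (FullSpectrum A) := {T | Chain.Inverts T.base a}

/-- The natural homomorphism `A_a → A_𝒮` for a fraction `a ∈ 𝒮`. -/
def eval {n : ℕ} (a : Chain n A) {T : FullSpectrum A} (h : T ∈ D a) : a.ring →+* T.Localization :=
  Chain.lift T.base a h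

theorem eval_comp_base {n : ℕ} (a : Chain n A) {T : FullSpectrum A} (h : T ∈ D a) :
    (eval a h).comp a.base = T.base := Chain.lift_comp_base _ _ _

/-- The topology on `F(A)` generated by the sets `D(a)`, `a` a fraction. -/
instance : TopologicalSpace (FullSpectrum A) :=
  TopologicalSpace.generateFrom
    {U | ∃ (n : ℕ) (a : Chain n A), a.IsFraction ∧ U = D a}

end

variable (A : Type u) [Ring A]

/-- `F(A)` as a topological space. -/
abbrev top : TopCat.{u} := TopCat.of (FullSpectrum A)

variable {A}

/-- The family of rings `A_𝒮`. -/
abbrev Stalks (T : top A) : Type u := FullSpectrum.Localization (A := A) T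

/-- `t(𝒮)` is given on the whole of `U` by one element `b ∈ A_a`, for a fraction `a` that belongs
to all `𝒮 ∈ U`. -/
def IsConst {U : Opens (top A)} (t : ∀ T : U, Stalks T.1) : Prop :=
  ∃ (n : ℕ) (a : Chain n A) (_ : a.IsFraction) (b : a.ring),
    ∀ T : U, ∃ h : T.1 ∈ D a, t T = eval a h b

variable (A)

/-- `IsConst` as a prelocal predicate. -/
def isConstPrelocal : TopCat.PrelocalPredicate (Stalks (A := A)) where
  pred t := IsConst t
  res := by
    rintro U V i t ⟨n, a, ha, b, h⟩
    exact ⟨n, a, ha, b, fun T => h ⟨T.1, i.le T.2⟩⟩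

/-- The functions `t` on open subsets of `F(A)` with `t(𝒮) ∈ A_𝒮` that are locally given by an
element `b ∈ A_a` for a fraction `a`. -/
def isLocallyConst : TopCat.LocalPredicate (Stalks (A := A)) := (isConstPrelocal A).sheafify

variable {A}

theorem IsConst.common {U V : Opens (top A)} {s : ∀ T : U, Stalks T.1} {t : ∀ T : V, Stalks T.1}
    (hs : IsConst s) (ht : IsConst t) :
    ∃ (n : ℕ) (a : Chain n A) (_ : a.IsFraction) (b c : a.ring),
      ∀ (T : top A) (h1 : T ∈ U) (h2 : T ∈ V), ∃ h : T ∈ D a,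
        s ⟨T, h1⟩ = eval a h b ∧ t ⟨T, h2⟩ = eval a h c := by
  obtain ⟨m, a, ha, x, hx⟩ := hs
  obtain ⟨n, b, hb, y, hy⟩ := ht
  obtain ⟨k, c, hc, h⟩ := Chain.exists_inter a ha b hb
  obtain ⟨ha', hb'⟩ := (h _ _).1 c.inverts_base
  refine ⟨k, c, hc, Chain.lift _ a ha' x, Chain.lift _ b hb' y, fun T h1 h2 => ?_⟩
  obtain ⟨h3, h4⟩ := hx ⟨T, h1⟩
  obtain ⟨h5, h6⟩ := hy ⟨T, h2⟩
  have hT : T ∈ D c := (h _ _).2 ⟨h3, h5⟩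
  refine ⟨hT, h4.trans ?_, h6.trans ?_⟩
  · have e : eval a h3 = (eval c hT).comp (Chain.lift _ a ha') := by
      apply Chain.hom_ext
      rw [RingHom.comp_assoc, Chain.lift_comp_base, eval_comp_base, eval_comp_base]
    exact congr($e x)
  · have e : eval b h5 = (eval c hT).comp (Chain.lift _ b hb') := by
      apply Chain.hom_ext
      rw [RingHom.comp_assoc, Chain.lift_comp_base, eval_comp_base, eval_comp_base]
    exact congr($e y)

theorem isConst_of_mem (r : A) (U : Opens (top A)) :
    IsConst (U := U) fun T => FullSpectrum.base T.1 r :=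
  ⟨0, PUnit.unit, trivial, r, fun _ => ⟨trivial, rfl⟩⟩

/-- The sections of the structure sheaf over `U`, a ring under pointwise operations. -/
def sectionsSubring (U : Opens (top A)) : Subring (∀ T : U, Stalks T.1) where
  carrier := {t | (isLocallyConst A).pred t}
  mul_mem' {s t} hs ht := TopCat.PrelocalPredicate.sheafify_inductionOn₂' _ _ (isConstPrelocal A)
    (fun x y => x * y) (fun {U V s t} hs ht => by
      obtain ⟨n, a, ha, b, c, h⟩ := IsConst.common hs ht
      refine ⟨n, a, ha, b * c, fun T => ?_⟩
      obtain ⟨hT, h1, h2⟩ := h T.1 T.2.1 T.2.2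
      exact ⟨hT, by rw [map_mul, ← h1, ← h2]⟩) hs ht
  add_mem' {s t} hs ht := TopCat.PrelocalPredicate.sheafify_inductionOn₂' _ _ (isConstPrelocal A)
    (fun x y => x + y) (fun {U V s t} hs ht => by
      obtain ⟨n, a, ha, b, c, h⟩ := IsConst.common hs ht
      refine ⟨n, a, ha, b + c, fun T => ?_⟩
      obtain ⟨hT, h1, h2⟩ := h T.1 T.2.1 T.2.2
      exact ⟨hT, by rw [map_add, ← h1, ← h2]⟩) hs ht
  neg_mem' {s} hs := TopCat.PrelocalPredicate.sheafify_inductionOn' (isConstPrelocal A)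
    (fun x => -x) (fun {U s} hs => by
      obtain ⟨n, a, ha, b, h⟩ := hs
      refine ⟨n, a, ha, -b, fun T => ?_⟩
      obtain ⟨hT, h1⟩ := h T
      exact ⟨hT, by rw [map_neg, ← h1]⟩) hs
  one_mem' := TopCat.PrelocalPredicate.sheafifyOf (P := isConstPrelocal A) (by
    have h := isConst_of_mem (1 : A) U
    simp only [map_one] at h
    exact h)
  zero_mem' := TopCat.PrelocalPredicate.sheafifyOf (P := isConstPrelocal A) (by
    have h := isConst_of_mem (0 : A) U
    simp only [map_zero] at h
    exact h)

variable (A)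

/-- The structure sheaf `𝒪_A` as a presheaf of rings: sections are the functions locally
given by elements `b ∈ A_a`, and restriction is restriction of functions. -/
def structurePresheaf : TopCat.Presheaf RingCat.{u} (top A) where
  obj U := RingCat.of (sectionsSubring (unop U))
  map {U V} i := RingCat.ofHom
    { toFun := fun t => ⟨fun T => t.1 ⟨T.1, i.unop.le T.2⟩, (isLocallyConst A).res i.unop t.1 t.2⟩
      map_one' := rfl
      map_mul' := fun _ _ => rfl
      map_zero' := rfl
      map_add' := fun _ _ => rfl }

/-- The underlying presheaf of sets is the sheaf of functions cut out by the local predicate. -/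
def structurePresheafCompForget :
    structurePresheaf A ⋙ forget RingCat.{u} ≅ (TopCat.subsheafToTypes (isLocallyConst A)).1 :=
  NatIso.ofComponents fun _ => Iso.refl _

theorem structurePresheaf_isSheaf : (structurePresheaf A).IsSheaf :=
  (TopCat.Presheaf.isSheaf_iff_isSheaf_comp (forget RingCat.{u}) _).mpr
    (TopCat.Presheaf.isSheaf_of_iso (structurePresheafCompForget A).symm
      (TopCat.subsheafToTypes (isLocallyConst A)).2)

end FullSpectrum

/-- Ringed spaces: topological spaces with a sheaf of (not necessarily commutative) rings. -/
abbrev RSpace : Type (u + 1) := AlgebraicGeometry.SheafedSpace.{u + 1, u, u} RingCat.{u}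

/-- The ringed space `(F(A), 𝒪_A)`. -/
def spaceF (A : Type u) [Ring A] : RSpace.{u} where
  carrier := FullSpectrum.top A
  presheaf := FullSpectrum.structurePresheaf A
  IsSheaf := FullSpectrum.structurePresheaf_isSheaf A

/-- The open subspace of a ringed space given by an open subset. -/
abbrev RSpace.openSub (X : RSpace.{u}) (U : Opens X.carrier) : RSpace.{u} :=
  X.restrict U.isOpenEmbedding

/-- An affine F-scheme: a ringed space isomorphic to `(F(A), 𝒪_A)` for some ring `A`. The zero ring
is allowed; its full spectrum is empty. -/
def IsAffine (X : RSpace.{u}) : Prop :=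
  ∃ (A : Type u) (_ : Ring A), Nonempty (X ≅ spaceF A)

/-- An F-scheme: a ringed space that is locally isomorphic to affine F-schemes. -/
def IsFScheme (X : RSpace.{u}) : Prop :=
  ∀ x : X.carrier, ∃ U : Opens X.carrier, x ∈ U ∧ IsAffine (X.openSub U)

/-- `0`-affine means affine. For `n ≥ 1`, `X` is `n`-affine if it has an open affine covering such
that each intersection of two members is `m`-affine for some `m ≤ n - 1`, and `X` is not `m`-affine
for any `m < n`. -/
def IsNAffine : ℕ → RSpace.{u} → Prop
  | 0, X => IsAffine X
  | n + 1, X =>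
    (∃ 𝒰 : Set (Opens X.carrier), sSup 𝒰 = ⊤ ∧ (∀ U ∈ 𝒰, IsAffine (X.openSub U)) ∧
      ∀ U ∈ 𝒰, ∀ V ∈ 𝒰, ∃ m : Fin (n + 1), IsNAffine m.1 (X.openSub (U ⊓ V))) ∧
    ∀ m : Fin (n + 1), ¬ IsNAffine m.1 X
termination_by n => n
decreasing_by all_goals exact m.2

end FS

end

noncomputable section

namespace FS

/-! ### Chains of localizations and homomorphisms that reflect units. -/

namespace Chain

variable {A B C : Type u} [Ring A] [Ring B] [Ring C]

/-! The point is that the basic open sets `D(a)` of an affine F-scheme are affine and closed under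
finite intersection. Given this, an open subspace `W` of an affine one is covered by the `D(a)`
inside it, whose intersections are again affine, so `W` is affine or 1-affine. In an arbitrary
F-scheme take all affine open subspaces as the covering: each `U ∩ V` is open in the affine `U`,
hence affine or 1-affine, and so the whole space is at most 2-affine.

Closure under intersection is `Chain.exists_inter`. That `D(a)` is affine is proved by induction on
the length of the fraction: for a single element `a`, the map `F(A_a) → F(A)` is an open immersion
(`isOpenImmersion_spaceFMap_of`) which carries `D(p)` onto `D(a, p)`.

The tool throughout is reflection of units. If `𝒮` comes from `A → B`, the induced map `A_𝒮 → B`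
reflects units, and composing with such a map changes neither the system nor the chains that are
inverted. So every `𝒮` comes from `A → A_𝒮` (`ofHom_base`), and points and stalks over `A` and `A_a`
can be compared by universal properties alone. -/

/-- Maps out of `Loc S` are determined on `A`, so any extension `ψ` of `φ` may stand in for
`Loc.lift φ h`. -/
theorem inverts_succ {n : ℕ} {φ : A →+* B} {S : Set A} {p : Chain n (Loc S)} {ψ : Loc S →+* B}
    (hψ : ψ.comp (Loc.of S) = φ) : Inverts (n := n + 1) φ ⟨S, p⟩ ↔ Inverts ψ p := by
  subst hψ
  have h1 : ∀ s ∈ S, IsUnit (ψ.comp (Loc.of S) s) := fun s hs => (Loc.isUnit_of hs).map ψ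
  have e : Loc.lift (ψ.comp (Loc.of S)) h1 = ψ := Loc.lift_comp _ _
  constructor
  · rintro ⟨h, h2⟩
    exact (congrArg (fun f => Inverts f p) e).mp h2
  · intro h2
    exact ⟨h1, (congrArg (fun f => Inverts f p) e).mpr h2⟩

theorem ofHom_succ {n : ℕ} (φ : A →+* B) {S : Set A} (hS : S = {a | IsUnit (φ a)})
    {ψ : Loc S →+* B} (hψ : ψ.comp (Loc.of S) = φ) :
    ofHom (n + 1) φ = (⟨S, ofHom n ψ⟩ : Chain (n + 1) A) := by
  subst hS
  have e : Loc.lift (S := {a | IsUnit (φ a)}) φ (fun _ h => h) = ψ :=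
    Loc.hom_ext ((Loc.lift_comp_of _ _).trans hψ.symm)
  change (⟨_, ofHom n (Loc.lift (S := {a | IsUnit (φ a)}) φ fun _ h => h)⟩ : Chain (n + 1) A) = _
  rw [e]

/-- Composition with a homomorphism that reflects units does not change the fully invertible
system. -/
theorem ofHom_comp (n : ℕ) (φ : A →+* B) (f : B →+* C) [IsLocalHom f] :
    ofHom n (f.comp φ) = ofHom n φ := by
  induction n generalizing A with
  | zero => rfl
  | succ n ih =>
    have hS : {a | IsUnit (φ a)} = {a | IsUnit (f.comp φ a)} := by
      ext a
      exact (isUnit_map_iff f (φ a)).symm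
    have h := Loc.lift_comp_of (S := {a | IsUnit (φ a)}) φ fun _ h => h
    rw [ofHom_succ φ rfl h,
      ofHom_succ (ψ := f.comp (Loc.lift (S := {a | IsUnit (φ a)}) φ fun _ h => h)) (f.comp φ) hS
        (by rw [RingHom.comp_assoc, h]), ih]

theorem inverts_comp_iff {n : ℕ} {φ : A →+* B} {f : B →+* C} [IsLocalHom f] {p : Chain n A} :
    Inverts (f.comp φ) p ↔ Inverts φ p := by
  refine ⟨fun h => ?_, fun h => h.comp f⟩
  induction n generalizing A with
  | zero => trivial
  | succ n ih =>
    have h1 : ∀ s ∈ p.1, IsUnit (φ s) := fun s hs => (isUnit_map_iff f _).1 (h.fst s hs)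
    refine ⟨h1, ih ?_⟩
    exact (inverts_succ (by rw [RingHom.comp_assoc, Loc.lift_comp_of])).1 h

theorem inverts_ofHom (n : ℕ) (φ : A →+* B) : Inverts φ (ofHom n φ) := by
  induction n generalizing A with
  | zero => trivial
  | succ n ih => exact ⟨fun _ h => h, ih _⟩

/-- An element of the `n`-th stage that becomes a unit in `B` belongs to `Sₙ₊₁`, so the next stage
inverts it. The maps `g` and `ψ` are fixed only by their restrictions to `A`, which lets the
induction replace `A` by `A_{S₁}`. -/
theorem isUnit_of_isUnit_lift {n : ℕ} {φ : A →+* B}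
    {g : (ofHom n φ).ring →+* B} (hg : g.comp (base _) = φ)
    {ψ : (ofHom n φ).ring →+* (ofHom (n + 1) φ).ring} (hψ : ψ.comp (base _) = base _)
    {x : (ofHom n φ).ring} (hx : IsUnit (g x)) : IsUnit (ψ x) := by
  induction n generalizing A with
  | zero =>
    have hx : IsUnit (φ x) := congrArg (fun f : A →+* B => IsUnit (f x)) hg |>.mp hx
    have := Loc.isUnit_of (S := {a | IsUnit (φ a)}) hx
    exact (congrArg (fun f : A →+* Loc {a | IsUnit (φ a)} => IsUnit (f x)) hψ).mpr this
  | succ n ih =>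
    let φ' := Loc.lift (S := {a | IsUnit (φ a)}) φ fun _ h => h
    refine ih (φ := φ') (Loc.hom_ext ?_) (ψ := ψ) (Loc.hom_ext hψ) hx
    rw [Loc.lift_comp_of]
    exact hg

end Chain

/-! ### Fully invertible systems, their localizations, and functoriality. -/

namespace FullSpectrum

variable {A B C : Type u} [Ring A] [Ring B] [Ring C]

/-- The fully invertible system coming from a homomorphism to a nonzero ring. -/
def ofHom [Nontrivial B] (φ : A →+* B) : FullSpectrum A where
  chain n := Chain.ofHom n φ
  exists_hom := ⟨B, _, ‹_›, φ, fun _ => rfl⟩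

theorem ofHom_comp [Nontrivial B] [Nontrivial C] (φ : A →+* B) (f : B →+* C) [IsLocalHom f] :
    ofHom (f.comp φ) = ofHom φ :=
  FullSpectrum.ext (funext fun n => Chain.ofHom_comp n φ f)

variable (T : FullSpectrum A)

/-- The natural homomorphism from a stage to the direct limit. -/
def stage (n : ℕ) : (T.chain n).ring →+* T.Localization :=
  DirectLimit.Ring.of (fun n => (T.chain n).ring) T.trans n

theorem stage_comp_trans {m n : ℕ} (h : m ≤ n) : (T.stage n).comp (T.trans m n h) = T.stage m :=
  RingHom.ext fun x => DirectLimit.Ring.of_f (f := T.trans) h x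

theorem trans_comp_base {m n : ℕ} (h : m ≤ n) :
    (T.trans m n h).comp (T.chain m).base = (T.chain n).base := Chain.lift_comp_base _ _ _

theorem stage_comp_base (n : ℕ) : (T.stage n).comp (T.chain n).base = T.base := by
  rw [← T.trans_comp_base (Nat.zero_le n), ← RingHom.comp_assoc, stage_comp_trans]
  rfl

theorem exists_stage (x : T.Localization) : ∃ n y, T.stage n y = x := by
  obtain ⟨n, y, rfl⟩ := DirectLimit.exists_eq_mk (f := T.trans) x
  exact ⟨n, y, rfl⟩

variable {T}

theorem hom_ext {f g : T.Localization →+* B} (h : f.comp T.base = g.comp T.base) : f = g := by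
  ext x
  obtain ⟨n, y, rfl⟩ := T.exists_stage x
  have e : f.comp (T.stage n) = g.comp (T.stage n) := by
    apply Chain.hom_ext
    rw [RingHom.comp_assoc, RingHom.comp_assoc, stage_comp_base, h]
  exact congr($e y)

/-- The homomorphism `A_𝒮 → B` induced by a homomorphism `A → B` inverting `𝒮`. -/
def lift (φ : A →+* B) (h : ∀ n, Chain.Inverts φ (T.chain n)) : T.Localization →+* B :=
  DirectLimit.Ring.lift (fun n => (T.chain n).ring) T.trans B (fun n => Chain.lift φ _ (h n))
    fun i j hij x => by
      have e : (Chain.lift φ _ (h j)).comp (T.trans i j hij) = Chain.lift φ _ (h i) := by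
        apply Chain.hom_ext
        rw [RingHom.comp_assoc, trans_comp_base, Chain.lift_comp_base, Chain.lift_comp_base]
      exact congr($e x)

theorem lift_comp_stage (φ : A →+* B) (h : ∀ n, Chain.Inverts φ (T.chain n)) (n : ℕ) :
    (lift φ h).comp (T.stage n) = Chain.lift φ _ (h n) := rfl

theorem lift_comp_base (φ : A →+* B) (h : ∀ n, Chain.Inverts φ (T.chain n)) :
    (lift φ h).comp T.base = φ := by
  rw [← T.stage_comp_base 0, ← RingHom.comp_assoc, lift_comp_stage, Chain.lift_comp_base]

/-- The homomorphism `A_𝒮 → B` induced by `φ` reflects units, if `𝒮` comes from `φ`. -/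
theorem isLocalHom_of_comp_base {φ : A →+* B} (hφ : ∀ n, T.chain n = Chain.ofHom n φ)
    {g : T.Localization →+* B} (hg : g.comp T.base = φ) : IsLocalHom g where
  map_nonunit x hx := by
    obtain ⟨c, e⟩ := T
    -- The stage rings depend on the chain, so the chain itself is substituted rather than
    -- rewritten.
    obtain rfl : c = fun n => Chain.ofHom n φ := funext hφ
    let T : FullSpectrum A := ⟨fun n => Chain.ofHom n φ, e⟩
    obtain ⟨n, y, rfl⟩ := T.exists_stage x
    have h : IsUnit (T.trans n (n + 1) n.le_succ y) := by
      refine Chain.isUnit_of_isUnit_lift (n := n) (φ := φ) (g := g.comp (T.stage n)) ?_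
        (ψ := T.trans n (n + 1) n.le_succ) ?_ hx
      · exact (RingHom.comp_assoc _ _ _).trans
          ((congrArg (fun f => g.comp f) (T.stage_comp_base n)).trans hg)
      · exact T.trans_comp_base n.le_succ
    have h' := h.map (T.stage (n + 1))
    rwa [← RingHom.comp_apply, T.stage_comp_trans] at h'

theorem exists_localHom (T : FullSpectrum A) : ∃ (B : Type u) (_ : Ring B) (_ : Nontrivial B)
    (g : T.Localization →+* B), IsLocalHom g := by
  obtain ⟨B, _, _, φ, hφ⟩ := T.exists_hom
  have h : ∀ n, Chain.Inverts φ (T.chain n) := fun n => by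
    rw [hφ]
    exact Chain.inverts_ofHom n φ
  exact ⟨B, _, ‹_›, lift φ h, isLocalHom_of_comp_base hφ (lift_comp_base φ h)⟩

instance : Nontrivial T.Localization := by
  obtain ⟨B, _, _, g, -⟩ := T.exists_localHom
  exact g.domain_nontrivial

/-- A homomorphism defining `𝒮` factors through `A_𝒮` by a unit-reflecting map, which does not
affect the system. -/
theorem ofHom_base (T : FullSpectrum A) : ofHom T.base = T := by
  obtain ⟨B, _, _, φ, hφ⟩ := T.exists_hom
  have h : ∀ n, Chain.Inverts φ (T.chain n) := fun n => by
    rw [hφ]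
    exact Chain.inverts_ofHom n φ
  have hl : IsLocalHom (lift φ h) := isLocalHom_of_comp_base hφ (lift_comp_base φ h)
  rw [← ofHom_comp T.base (lift φ h), lift_comp_base]
  exact FullSpectrum.ext (funext fun n => (hφ n).symm)

/-- The homomorphism `A_𝒮 → B` for the fully invertible system `𝒮` coming from `A → B`. -/
def ofHomLift [Nontrivial B] (φ : A →+* B) : (ofHom φ).Localization →+* B :=
  lift φ fun n => Chain.inverts_ofHom n φ

theorem ofHomLift_comp_base [Nontrivial B] (φ : A →+* B) :
    (ofHomLift φ).comp (ofHom φ).base = φ := lift_comp_base _ _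

instance [Nontrivial B] (φ : A →+* B) : IsLocalHom (ofHomLift φ) :=
  isLocalHom_of_comp_base (φ := φ) (fun _ => rfl) (ofHomLift_comp_base φ)

theorem inverts_base_chain (T : FullSpectrum A) (n : ℕ) : Chain.Inverts T.base (T.chain n) := by
  rw [← T.stage_comp_base n]
  exact (Chain.inverts_base _).comp _

theorem inverts_base_ofHom [Nontrivial B] {n : ℕ} (φ : A →+* B) (p : Chain n A) :
    Chain.Inverts (ofHom φ).base p ↔ Chain.Inverts φ p := by
  conv_rhs => rw [← ofHomLift_comp_base φ]
  exact Chain.inverts_comp_iff.symm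

/-- The map `F(B) → F(A)` induced by a homomorphism `A → B`. -/
def comap (φ : A →+* B) (T : FullSpectrum B) : FullSpectrum A := ofHom (T.base.comp φ)

/-- The homomorphism `A_{φ⁻¹(𝒮)} → B_𝒮` induced by a homomorphism `φ : A → B`. -/
def stalkMap (φ : A →+* B) (T : FullSpectrum B) : (comap φ T).Localization →+* T.Localization :=
  ofHomLift (T.base.comp φ)

theorem stalkMap_comp_base (φ : A →+* B) (T : FullSpectrum B) :
    (stalkMap φ T).comp (comap φ T).base = T.base.comp φ := ofHomLift_comp_base _

instance (φ : A →+* B) (T : FullSpectrum B) : IsLocalHom (stalkMap φ T) :=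
  inferInstanceAs (IsLocalHom (ofHomLift _))

theorem comap_mem_D {φ : A →+* B} {T : FullSpectrum B} {n : ℕ} {a : Chain n A} :
    comap φ T ∈ D a ↔ T ∈ D (Chain.push φ a) :=
  (inverts_base_ofHom _ a).trans (Chain.inverts_push φ T.base a).symm

theorem continuous_comap (φ : A →+* B) : Continuous (comap φ) := by
  refine continuous_generateFrom_iff.2 ?_
  rintro _ ⟨n, a, ha, rfl⟩
  refine isOpen_generateFrom_of_mem ⟨n, Chain.push φ a, ha.push φ, ?_⟩
  ext T
  exact comap_mem_D

/-! ### Systems of `A_S` as the systems of `A` that invert `S`. -/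

section Loc

variable {S : Set A}

theorem inverts_base_comap_of (T : FullSpectrum (Loc S)) :
    ∀ s ∈ S, IsUnit ((comap (Loc.of S) T).base s) := fun s hs => by
  rw [← isUnit_map_iff (stalkMap (Loc.of S) T), ← RingHom.comp_apply, stalkMap_comp_base]
  exact (Loc.isUnit_of hs).map T.base

/-- A fully invertible system of `A` whose localization inverts `S`, as a system of `A_S`. -/
def extend (R : FullSpectrum A) (h : ∀ s ∈ S, IsUnit (R.base s)) : FullSpectrum (Loc S) :=
  ofHom (Loc.lift R.base h)

/-- The homomorphism from the localization at the extended system. -/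
def extendStalkMap (R : FullSpectrum A) (h : ∀ s ∈ S, IsUnit (R.base s)) :
    (extend R h).Localization →+* R.Localization := ofHomLift _

theorem extendStalkMap_comp_base (R : FullSpectrum A) (h : ∀ s ∈ S, IsUnit (R.base s)) :
    (extendStalkMap R h).comp (extend R h).base = Loc.lift R.base h := ofHomLift_comp_base _

theorem comap_extend (R : FullSpectrum A) (h : ∀ s ∈ S, IsUnit (R.base s)) :
    comap (Loc.of S) (extend R h) = R := by
  have : IsLocalHom (extendStalkMap R h) := inferInstanceAs (IsLocalHom (ofHomLift _))
  rw [comap, ← ofHom_comp _ (extendStalkMap R h), ← RingHom.comp_assoc, extendStalkMap_comp_base,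
    Loc.lift_comp_of, ofHom_base]

theorem stalkMap_comp_lift (T : FullSpectrum (Loc S))
    (h : ∀ s ∈ S, IsUnit ((comap (Loc.of S) T).base s)) :
    (stalkMap (Loc.of S) T).comp (Loc.lift (comap (Loc.of S) T).base h) = T.base :=
  Loc.hom_ext (by rw [RingHom.comp_assoc, Loc.lift_comp_of, stalkMap_comp_base])

theorem extend_comap (T : FullSpectrum (Loc S))
    (h : ∀ s ∈ S, IsUnit ((comap (Loc.of S) T).base s)) :
    extend (comap (Loc.of S) T) h = T := by
  rw [extend, ← ofHom_comp _ (stalkMap (Loc.of S) T), stalkMap_comp_lift, ofHom_base]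

/-- A system of `A_S` is recovered from its image by `extend`. -/
theorem comap_of_injective : Function.Injective (comap (Loc.of S)) := by
  intro T T' e
  -- A variable `R` is needed because the proof `h` depends on the system.
  have key : ∀ R (hR : comap (Loc.of S) T = R) (h : ∀ s ∈ S, IsUnit (R.base s)),
      T = extend R h := by
    rintro _ rfl h
    exact (extend_comap T h).symm
  rw [key _ e (inverts_base_comap_of T'), extend_comap]

/-- The stalk map has a left inverse: the map from `A_S` to the stalk over `A` inverts `T`, since
the stalk map reflects units, and therefore factors through the localization at `T`. -/
theorem stalkMap_of_injective (T : FullSpectrum (Loc S)) :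
    Function.Injective (stalkMap (Loc.of S) T) := by
  have h := inverts_base_comap_of T
  have hT : ∀ n, Chain.Inverts (Loc.lift (comap (Loc.of S) T).base h) (T.chain n) := fun n => by
    rw [← Chain.inverts_comp_iff (f := stalkMap (Loc.of S) T), stalkMap_comp_lift]
    exact T.inverts_base_chain n
  have e : (lift _ hT).comp (stalkMap (Loc.of S) T) = RingHom.id _ := hom_ext (by
    rw [RingHom.comp_assoc, stalkMap_comp_base, ← RingHom.comp_assoc, lift_comp_base,
      Loc.lift_comp_of, RingHom.id_comp])
  exact Function.LeftInverse.injective (g := lift _ hT) fun x => congr($e x)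

theorem stalkMap_extendStalkMap (T : FullSpectrum (Loc S))
    (h : ∀ s ∈ S, IsUnit ((comap (Loc.of S) T).base s)) :
    (stalkMap (Loc.of S) T).comp ((extendStalkMap _ h).comp
      (extend (comap (Loc.of S) T) h).base) = T.base := by
  rw [extendStalkMap_comp_base, stalkMap_comp_lift]

theorem extend_mem_D {n : ℕ} {p : Chain n (Loc S)} {R : FullSpectrum A}
    (h : ∀ s ∈ S, IsUnit (R.base s)) :
    extend R h ∈ D p ↔ R ∈ D (n := n + 1) (A := A) ⟨S, p⟩ := by
  refine (inverts_base_ofHom _ p).trans (Chain.inverts_succ ?_).symm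
  exact Loc.lift_comp_of _ _

theorem comap_of_mem_D {n : ℕ} {p : Chain n (Loc S)} {T : FullSpectrum (Loc S)} :
    comap (Loc.of S) T ∈ D (n := n + 1) (A := A) ⟨S, p⟩ ↔ T ∈ D p := by
  rw [← extend_mem_D (inverts_base_comap_of T), extend_comap]

theorem image_comap_of_D {n : ℕ} (p : Chain n (Loc S)) :
    comap (Loc.of S) '' D p = D (n := n + 1) (A := A) ⟨S, p⟩ := by
  ext R
  constructor
  · rintro ⟨T, hT, rfl⟩
    exact comap_of_mem_D.2 hT
  · rintro hR
    exact ⟨extend R hR.fst, (extend_mem_D _).2 hR, comap_extend _ _⟩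

end Loc

theorem isTopologicalBasis_D : IsTopologicalBasis
    {U : Set (FullSpectrum A) | ∃ (n : ℕ) (a : Chain n A), a.IsFraction ∧ U = D a} where
  exists_subset_inter := by
    rintro _ ⟨m, a, ha, rfl⟩ _ ⟨n, b, hb, rfl⟩ T ⟨h1, h2⟩
    obtain ⟨k, c, hc, h⟩ := Chain.exists_inter a ha b hb
    exact ⟨D c, ⟨k, c, hc, rfl⟩, (h _ _).2 ⟨h1, h2⟩, fun T' h' => (h _ _).1 h'⟩
  sUnion_eq := Set.eq_univ_of_forall fun _ =>
    ⟨_, ⟨0, PUnit.unit, trivial, rfl⟩, trivial⟩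
  eq_generateFrom := rfl

/-- Openness rests on prepending `a` to a fraction of `A_a`, which gives a fraction of `A`; a
general set `S` in place of `{a}` would not. -/
theorem isOpenEmbedding_comap_of (a : A) : Topology.IsOpenEmbedding (comap (Loc.of {a})) := by
  refine .of_continuous_injective_isOpenMap (continuous_comap _) comap_of_injective ?_
  rw [isTopologicalBasis_D.isOpenMap_iff]
  rintro _ ⟨n, p, hp, rfl⟩
  rw [image_comap_of_D]
  exact isOpen_generateFrom_of_mem ⟨n + 1, (⟨{a}, p⟩ : Σ S : Set A, Chain n (Loc S)), ⟨⟨a, rfl⟩, hp⟩, rfl⟩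

end FullSpectrum

/-! ### Comparison of the structure sheaves of `F(A_a)` and `F(A)`. -/

namespace FullSpectrum

variable {A B : Type u} [Ring A] [Ring B]

/-- The continuous map `F(B) → F(A)` induced by a homomorphism `A → B`. -/
def comapTop (φ : A →+* B) : top B ⟶ top A := TopCat.ofHom ⟨comap φ, continuous_comap φ⟩

theorem stalkMap_eval (φ : A →+* B) {n : ℕ} {a : Chain n A} (x : a.ring) {T : FullSpectrum B}
    (h : comap φ T ∈ D a) :
    stalkMap φ T (eval a h x) = eval (Chain.push φ a) (comap_mem_D.1 h)
      (Chain.lift _ a ((Chain.inverts_push φ _ a).1 (Chain.inverts_base _)) x) := by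
  have e : (stalkMap φ T).comp (eval a h) = (eval (Chain.push φ a) (comap_mem_D.1 h)).comp
      (Chain.lift _ a ((Chain.inverts_push φ _ a).1 (Chain.inverts_base _))) := by
    apply Chain.hom_ext
    rw [RingHom.comp_assoc, RingHom.comp_assoc, eval_comp_base, Chain.lift_comp_base,
      stalkMap_comp_base, ← RingHom.comp_assoc, eval_comp_base]
  exact congr($e x)

/-- Pull back a section along `F(B) → F(A)`. -/
def pullbackSection (φ : A →+* B) (U : Opens (top A)) :
    sectionsSubring U →+* sectionsSubring ((Opens.map (comapTop φ)).obj U) where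
  toFun t := ⟨fun T => stalkMap φ T.1 (t.1 ⟨comap φ T.1, T.2⟩), fun T => by
    obtain ⟨V, hV, i, n, a, ha, b, h⟩ := t.2 ⟨comap φ T.1, T.2⟩
    refine ⟨(Opens.map (comapTop φ)).obj V, hV, (Opens.map (comapTop φ)).map i,
      n, Chain.push φ a, ha.push φ,
      Chain.lift _ a ((Chain.inverts_push φ _ a).1 (Chain.inverts_base _)) b, fun T' => ?_⟩
    obtain ⟨h1, h2⟩ := h ⟨comap φ T'.1, T'.2⟩
    exact ⟨comap_mem_D.1 h1, (congrArg (stalkMap φ T'.1) h2).trans (stalkMap_eval φ b h1)⟩⟩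
  map_one' := Subtype.ext (funext fun _ => map_one _)
  map_mul' _ _ := Subtype.ext (funext fun _ => map_mul _ _ _)
  map_zero' := Subtype.ext (funext fun _ => map_zero _)
  map_add' _ _ := Subtype.ext (funext fun _ => map_add _ _ _)

theorem extendStalkMap_eval {S : Set A} {n : ℕ} {p : Chain n (Loc S)} (x : p.ring)
    {R : FullSpectrum A} (h : ∀ s ∈ S, IsUnit (R.base s)) (h1 : extend R h ∈ D p) :
    extendStalkMap R h (eval p h1 x) =
      eval (n := n + 1) (A := A) ⟨S, p⟩ ((extend_mem_D h).1 h1) x := by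
  have e : (extendStalkMap R h).comp (eval p h1) =
      eval (n := n + 1) (A := A) ⟨S, p⟩ ((extend_mem_D h).1 h1) := by
    refine Chain.hom_ext p (Loc.hom_ext ?_)
    have e1 : ((extendStalkMap R h).comp (eval p h1)).comp p.base = Loc.lift R.base h := by
      rw [RingHom.comp_assoc, eval_comp_base, extendStalkMap_comp_base]
    refine ((congrArg (fun f => f.comp (Loc.of S)) e1).trans (Loc.lift_comp_of _ _)).trans ?_
    exact (eval_comp_base (n := n + 1) (A := A) ⟨S, p⟩ ((extend_mem_D h).1 h1)).symm
  exact congr($e x)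

theorem pullbackSection_injective {S : Set A} {U : Opens (top A)}
    (hU : (U : Set (top A)) ⊆ Set.range (comap (Loc.of S))) :
    Function.Injective (pullbackSection (Loc.of S) U) := by
  intro s t e
  refine Subtype.ext (funext fun ⟨R, hR⟩ => ?_)
  obtain ⟨T, rfl⟩ := hU hR
  exact stalkMap_of_injective T (congrFun (congrArg Subtype.val e) ⟨T, hR⟩)

theorem pullbackSection_surjective (a : A) {U : Opens (top A)}
    (hU : (U : Set (top A)) ⊆ Set.range (comap (Loc.of {a}))) :
    Function.Surjective (pullbackSection (Loc.of {a}) U) := by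
  intro t
  have h : ∀ R : U, ∀ s ∈ ({a} : Set A), IsUnit (FullSpectrum.base (A := A) R.1 s) := by
    rintro ⟨R, hR⟩
    obtain ⟨T, rfl⟩ := hU hR
    exact inverts_base_comap_of T
  have hext : ∀ R : U, extend R.1 (h R) ∈ (Opens.map (comapTop (Loc.of {a}))).obj U := fun R => by
    change comap _ (extend R.1 (h R)) ∈ U
    rw [comap_extend]
    exact R.2
  refine ⟨⟨fun R => extendStalkMap R.1 (h R) (t.1 ⟨_, hext R⟩), fun R => ?_⟩, ?_⟩
  · obtain ⟨V, hV, i, n, p, hp, b, hb⟩ := t.2 ⟨_, hext R⟩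
    have hVU : comap (Loc.of {a}) '' V ⊆ U := by
      rintro _ ⟨T, hT, rfl⟩
      exact i.le hT
    -- The rings at `p` and at `(a, p)` are definitionally the same, so the same `b` represents the
    -- section.
    refine ⟨⟨comap (Loc.of {a}) '' V, (isOpenEmbedding_comap_of a).isOpenMap _ V.2⟩,
      ⟨_, hV, comap_extend _ _⟩, homOfLE hVU, n + 1, (⟨{a}, p⟩ : Σ S : Set A, Chain n (Loc S)),
      ⟨⟨a, rfl⟩, hp⟩, b, fun R' => ?_⟩
    obtain ⟨T, hT, e⟩ := R'.2
    have hR' : extend R'.1 (h ⟨R'.1, hVU R'.2⟩) ∈ V := by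
      have := comap_of_injective (e.trans (comap_extend R'.1 (h ⟨R'.1, hVU R'.2⟩)).symm)
      exact this ▸ hT
    obtain ⟨h1, h2⟩ := hb ⟨_, hR'⟩
    exact ⟨(extend_mem_D _).1 h1, (congrArg (extendStalkMap R'.1 _) h2).trans
      (extendStalkMap_eval b _ h1)⟩
  · refine Subtype.ext (funext fun T => ?_)
    -- Extending the image of `T` returns `T` only propositionally, hence the variable `T'`. After
    -- substitution the composite is an endomorphism of the stalk over `A_a`, thus the identity.
    have key : ∀ (T' : (Opens.map (comapTop (Loc.of {a}))).obj U) (_ : T' = T)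
        (α : FullSpectrum.Localization T'.1 →+* (comap (Loc.of {a}) T.1).Localization)
        (_ : (stalkMap (Loc.of {a}) T.1).comp (α.comp (FullSpectrum.base T'.1)) =
          FullSpectrum.base T.1),
        stalkMap (Loc.of {a}) T.1 (α (t.1 T')) = t.1 T := by
      rintro T' rfl α hα
      have e : (stalkMap (Loc.of {a}) T'.1).comp α = RingHom.id _ := hom_ext (by
        rw [RingHom.comp_assoc, hα, RingHom.id_comp])
      exact congr($e (t.1 T'))
    exact key ⟨_, hext ⟨_, T.2⟩⟩ (Subtype.ext (extend_comap T.1 _)) _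
      (stalkMap_extendStalkMap T.1 _)

end FullSpectrum

/-! ### Basic open sets as ranges of open immersions. -/

open FullSpectrum

variable {A B : Type u} [Ring A] [Ring B]

/-- The morphism of ringed spaces `F(B) → F(A)` induced by a homomorphism `A → B`. -/
def spaceFMap (φ : A →+* B) : (spaceF B).toPresheafedSpace ⟶ (spaceF A).toPresheafedSpace where
  base := comapTop φ
  c :=
    { app := fun U => RingCat.ofHom (pullbackSection φ (unop U))
      naturality := fun _ _ _ => rfl }

instance isOpenImmersion_spaceFMap_of (a : A) :
    AlgebraicGeometry.PresheafedSpace.IsOpenImmersion (spaceFMap (Loc.of {a})) where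
  base_open := isOpenEmbedding_comap_of a
  c_iso U := by
    refine (ConcreteCategory.isIso_iff_bijective _).2 ⟨pullbackSection_injective ?_,
      pullbackSection_surjective a ?_⟩
    all_goals exact Set.image_subset_range _ _

/-- The basic open subset `D(a)` is the range of an open immersion of an affine F-scheme. -/
theorem exists_isOpenImmersion_range_eq_D {n : ℕ} {A : Type u} [Ring A] (a : Chain n A)
    (ha : a.IsFraction) : ∃ (B : Type u) (_ : Ring B)
      (f : (spaceF B).toPresheafedSpace ⟶ (spaceF A).toPresheafedSpace),
      AlgebraicGeometry.PresheafedSpace.IsOpenImmersion f ∧ Set.range f.base = D a := by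
  induction n generalizing A with
  | zero =>
    refine ⟨A, _, 𝟙 _, inferInstance, ?_⟩
    exact Set.range_id.trans (Set.eq_univ_of_forall fun _ => trivial).symm
  | succ n ih =>
    obtain ⟨S, p⟩ := a
    obtain ⟨⟨a, rfl⟩, hp⟩ := ha
    obtain ⟨B, _, f, _, hr⟩ := ih p hp
    refine ⟨B, _, f ≫ spaceFMap (Loc.of {a}), inferInstance, ?_⟩
    rw [← image_comap_of_D, ← hr]
    exact Set.range_comp (comap (Loc.of {a})) f.base

/-! ### Open subspaces of affine F-schemes. -/

open FullSpectrum AlgebraicGeometry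

/-- An open subspace is affine if it is the range of an open immersion of an affine F-scheme. -/
theorem isAffine_of_range_eq {X Y Z : RSpace.{u}} (hZ : IsAffine Z)
    (f : Z.toPresheafedSpace ⟶ X.toPresheafedSpace) [PresheafedSpace.IsOpenImmersion f]
    (g : Y.toPresheafedSpace ⟶ X.toPresheafedSpace) [PresheafedSpace.IsOpenImmersion g]
    (h : Set.range g.base = Set.range f.base) : IsAffine Y := by
  obtain ⟨A, _, ⟨e⟩⟩ := hZ
  exact ⟨A, _, ⟨SheafedSpace.isoMk (PresheafedSpace.IsOpenImmersion.isoOfRangeEq g f h) ≪≫ e⟩⟩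

/-- The inclusion of an open subspace. -/
def openSubι (X : RSpace.{u}) (U : Opens X.carrier) :
    (X.openSub U).toPresheafedSpace ⟶ X.toPresheafedSpace :=
  X.toPresheafedSpace.ofRestrict U.isOpenEmbedding

instance (X : RSpace.{u}) (U : Opens X.carrier) :
    PresheafedSpace.IsOpenImmersion (openSubι X U) :=
  PresheafedSpace.IsOpenImmersion.ofRestrict _ _

theorem range_openSubι (X : RSpace.{u}) (U : Opens X.carrier) :
    Set.range (openSubι X U).base = U := Subtype.range_coe

theorem isAffine_spaceF (A : Type u) [Ring A] : IsAffine (spaceF A) := ⟨A, _, ⟨Iso.refl _⟩⟩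

theorem exists_isOpenImmersion_of_isAffine {X : RSpace.{u}} {U : Opens X.carrier}
    (hU : IsAffine (X.openSub U)) : ∃ (A : Type u) (_ : Ring A)
      (f : (spaceF A).toPresheafedSpace ⟶ X.toPresheafedSpace),
      PresheafedSpace.IsOpenImmersion f ∧ Set.range f.base = U := by
  obtain ⟨A, _, ⟨e⟩⟩ := hU
  let e' : (spaceF A).toPresheafedSpace ≅ (X.openSub U).toPresheafedSpace :=
    SheafedSpace.forgetToPresheafedSpace.mapIso e.symm
  have : PresheafedSpace.IsOpenImmersion e'.hom := .ofIso e'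
  refine ⟨A, _, e'.hom ≫ openSubι X U, inferInstance, ?_⟩
  have hs : Function.Surjective e'.hom.base :=
    (TopCat.homeoOfIso ((PresheafedSpace.forget _).mapIso e')).surjective
  refine (Set.range_comp (openSubι X U).base e'.hom.base).trans ?_
  rw [hs.range_eq, Set.image_univ, range_openSubι]

/-- An open subspace of an affine open subspace is covered by affine open subspaces with affine
intersections. -/
theorem exists_cover_of_le {X : RSpace.{u}} {U W : Opens X.carrier} (hU : IsAffine (X.openSub U))
    (hW : W ≤ U) : ∃ 𝒰 : Set (Opens (X.openSub W).carrier), sSup 𝒰 = ⊤ ∧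
      (∀ V ∈ 𝒰, IsAffine ((X.openSub W).openSub V)) ∧
      ∀ V ∈ 𝒰, ∀ V' ∈ 𝒰, IsAffine ((X.openSub W).openSub (V ⊓ V')) := by
  obtain ⟨A, _, f, hf, hr⟩ := exists_isOpenImmersion_of_isAffine hU
  let ι := openSubι X W
  have hι : ∀ V : Opens (X.openSub W).carrier,
      Set.range (openSubι (X.openSub W) V ≫ ι).base = ι.base '' V := fun V => by
    refine (Set.range_comp ι.base (openSubι (X.openSub W) V).base).trans ?_
    rw [range_openSubι]
  -- `V` lives in `W` and `D a` in `F(A)`; they are compared through their images in `X`.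
  have key : ∀ (V : Opens (X.openSub W).carrier) (n : ℕ) (a : Chain n A), a.IsFraction →
      ι.base '' V = f.base '' (D a) → IsAffine ((X.openSub W).openSub V) := by
    intro V n a ha h
    obtain ⟨B, _, g, _, hg⟩ := exists_isOpenImmersion_range_eq_D a ha
    refine isAffine_of_range_eq (X := X) (isAffine_spaceF B) (g ≫ f)
      (openSubι (X.openSub W) V ≫ ι) ?_
    rw [hι, h, ← hg]
    exact (Set.range_comp f.base g.base).symm
  refine ⟨{V | ∃ (n : ℕ) (a : Chain n A), a.IsFraction ∧ ι.base '' V = f.base '' (D a)},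
    ?_, ?_, ?_⟩
  · refine top_unique fun x _ => ?_
    obtain ⟨y, hy⟩ : ι.base x ∈ Set.range f.base := hr ▸ hW x.2
    have hWo : IsOpen (f.base ⁻¹' (W : Set X.carrier)) := W.2.preimage f.base.hom.continuous
    have hyW : y ∈ f.base ⁻¹' (W : Set X.carrier) := by
      change f.base y ∈ W
      rw [hy]
      exact x.2
    -- As the `D a` form a basis, one of them contains `y` and maps into `W`.
    obtain ⟨_, ⟨n, a, ha, rfl⟩, hya, hsub⟩ :=
      isTopologicalBasis_D.exists_subset_of_mem_open (a := y) hyW hWo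
    have hopen : IsOpen (f.base '' (D a)) := hf.base_open.isOpenMap _
      (isOpen_generateFrom_of_mem ⟨n, a, ha, rfl⟩)
    refine Opens.mem_sSup.2 ⟨⟨ι.base ⁻¹' (f.base '' (D a)),
      hopen.preimage ι.base.hom.continuous⟩, ⟨n, a, ha, ?_⟩, ?_⟩
    · refine Set.image_preimage_eq_of_subset (f := ι.base) (s := f.base '' (D a)) ?_
      rw [range_openSubι]
      exact Set.image_subset_iff.2 hsub
    · exact ⟨y, hya, hy⟩
  · rintro V ⟨n, a, ha, h⟩
    exact key V n a ha h
  · rintro V ⟨m, a, ha, h⟩ V' ⟨n, b, hb, h'⟩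
    obtain ⟨k, c, hc, hcD⟩ := Chain.exists_inter a ha b hb
    refine key _ k c hc ?_
    -- Both embeddings into `X` are injective, so taking images commutes with this intersection.
    have e : D c = D a ∩ D b := Set.ext fun T => hcD _ _
    have hi := Set.image_inter (s := D a) (t := D b) hf.base_open.injective
    rw [e]
    exact ((Set.image_inter (PresheafedSpace.IsOpenImmersion.base_open (f := ι)).injective).trans
      (congrArg₂ (· ∩ ·) h h')).trans hi.symm

/-! ### The bound on `n`. -/

theorem isNAffine_zero {X : RSpace.{u}} : IsNAffine 0 X ↔ IsAffine X := by
  rw [IsNAffine]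

theorem isNAffine_succ {n : ℕ} {X : RSpace.{u}} : IsNAffine (n + 1) X ↔
    (∃ 𝒰 : Set (Opens X.carrier), sSup 𝒰 = ⊤ ∧ (∀ U ∈ 𝒰, IsAffine (X.openSub U)) ∧
      ∀ U ∈ 𝒰, ∀ V ∈ 𝒰, ∃ m : Fin (n + 1), IsNAffine m.1 (X.openSub (U ⊓ V))) ∧
    ∀ m : Fin (n + 1), ¬ IsNAffine m.1 X := by
  rw [IsNAffine]

/-- An open subspace of an affine open subspace is affine or `1`-affine. -/
theorem isNAffine_of_le {X : RSpace.{u}} {U W : Opens X.carrier} (hU : IsAffine (X.openSub U))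
    (hW : W ≤ U) : ∃ m : Fin 2, IsNAffine m.1 (X.openSub W) := by
  by_cases h : IsAffine (X.openSub W)
  · exact ⟨0, isNAffine_zero.2 h⟩
  · obtain ⟨𝒰, h1, h2, h3⟩ := exists_cover_of_le hU hW
    refine ⟨1, isNAffine_succ.2 ⟨⟨𝒰, h1, h2, fun V hV V' hV' =>
      ⟨0, isNAffine_zero.2 (h3 V hV V' hV')⟩⟩, fun m hm => h ?_⟩⟩
    obtain rfl : m = 0 := Fin.fin_one_eq_zero m
    exact isNAffine_zero.1 hm

end FS

end

theorem mainTheorem6 (X : FS.RSpace.{u}) (hX : FS.IsFScheme X) :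
    FS.IsAffine X ∨ FS.IsNAffine 1 X ∨ FS.IsNAffine 2 X := by
  by_cases h0 : FS.IsAffine X
  · exact .inl h0
  by_cases h1 : FS.IsNAffine 1 X
  · exact .inr (.inl h1)
  -- The covering consists of all affine open subspaces; the excluded cases supply the minimality
  -- condition.
  refine .inr (.inr (FS.isNAffine_succ.2
    ⟨⟨{U | FS.IsAffine (X.openSub U)}, ?_, fun U hU => hU, fun U hU V _ => ?_⟩, fun m hm => ?_⟩))
  · refine top_unique fun x _ => ?_
    obtain ⟨U, hxU, hU⟩ := hX x
    exact Opens.mem_sSup.2 ⟨U, hU, hxU⟩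
  · exact FS.isNAffine_of_le hU inf_le_left
  · fin_cases m
    · exact h0 (FS.isNAffine_zero.1 hm)
    · exact h1 hm
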